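/- Let $N\ge 0$, $\mathbf T^N=\mathbf R^N/\mathbf Z^N$, and let $H\colon\mathbf T^N\times\mathbf R^N\to\mathbf R$ be continuous and quasiconvex in $p$, i.e. $H(x,\theta p+(1-\theta)q)\le\max\{H(x,p),H(x,q)\}$ for all $x\in\mathbf T^N$, $p,q\in\mathbf R^N$, $0\le\theta\le1$ (convexity in $p$ is not assumed). For $u\colon\mathbf T^N\to\mathbf R$ define $$\nabla u=\{(x,p)\in\mathbf T^N\times\mathbf R^N : u(y)=u(x)+p\cdot(y-x)+o(|y-x|)\text{ as }y\to x\},$$ and let $D^+u$ and $D^-u$ be the sets defined in the same way with $\le$ and $\ge$, respectively, in place of $=$. A function $u\in\mathrm{Lip}(\mathbf T^N)$ (the real Lipschitz functions on $\mathbf T^N$) is a viscosity subsolution of $H(x,Du)=a$, $a\in\mathbf R$, if $\sup_{D^+u}H\le a$; a viscosity supersolution if $\inf_{D^-u}H\ge a$; and a viscosity solution if both hold. A number $a\in\mathbf R$ is a subeigenvalue, a supereigenvalue or an eigenvalue if $H(x,Du)=a$ has a viscosity subsolution, supersolution or solution $u\in\mathrm{Lip}(\mathbf T^N)$, respectively.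 In $[-\infty,+\infty]$, let $$c^+(H)=\inf\{a\in\mathbf R: a\text{ is a subeigenvalue}\},\qquad c^-(H)=\sup\{a\in\mathbf R: a\text{ is a supereigenvalue}\}.$$ Then $$c^+(H)=\inf_{u\in\mathrm{Lip}(\mathbf T^N)}\ \sup_{(x,p)\in\nabla u}H(x,p)=\inf_{u\in C^\infty(\mathbf T^N)}\ \sup_{(x,p)\in\nabla u}H(x,p).$$ If, moreover, $H$ is coercive, i.e. $\liminf_{|p|\to\infty}\inf_{x\in\mathbf T^N}H(x,p)=+\infty$, then there is exactly one eigenvalue $c(H)\in\mathbf R$, and $c^-(H)=c^+(H)=c(H)$; in particular, the two minimax values above are equal to $c(H)$. -/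

import Mathlib

open Set Filter Topology
open scoped ContDiff InnerProductSpace

noncomputable section

namespace HamiltonJacobi

/-- The torus `𝕋^N = ℝ^N / ℤ^N`, as a product of circles `ℝ / ℤ`. -/
abbrev Torus (N : ℕ) : Type := UnitAddTorus (Fin N)

/-- The space `ℝ^N` with the Euclidean inner product. -/
abbrev Space (N : ℕ) : Type := EuclideanSpace ℝ (Fin N)

/-- The quotient map `ℝ^N → ℝ^N / ℤ^N`. -/
def proj {N : ℕ} (h : Space N) : Torus N := fun i => ((h i : ℝ) : UnitAddCircle)

/-- Lipschitz functions on the torus. The metric of `Torus N` is the maximum of the quotient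
metrics of the circles; it is equivalent to the flat metric, so the class is the same. -/
def Lip (N : ℕ) : Set (Torus N → ℝ) := {u | ∃ K : NNReal, LipschitzWith K u}

/-- Smooth functions on the torus: those with a `C^∞` periodic lift to `ℝ^N`. -/
def Smooth (N : ℕ) : Set (Torus N → ℝ) := {u | ContDiff ℝ ∞ (fun y : Space N => u (proj y))}

/-- The graph `∇u` of the classical gradients of `u`: the pairs `(x, p)` such that
`u (x + h) = u x + p · h + o(|h|)` as `h → 0`. -/
def gradGraph {N : ℕ} (u : Torus N → ℝ) : Set (Torus N × Space N) :=
  {z | HasGradientAt (fun h : Space N => u (z.1 + proj h)) z.2 0}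

/-- The graph `D⁺u` of the superdifferentials of `u`: the pairs `(x, p)` such that
`u (x + h) ≤ u x + p · h + o(|h|)` as `h → 0`. -/
def superGraph {N : ℕ} (u : Torus N → ℝ) : Set (Torus N × Space N) :=
  {z | ∀ ε : ℝ, 0 < ε → ∀ᶠ h : Space N in 𝓝 0,
    u (z.1 + proj h) ≤ u z.1 + ⟪z.2, h⟫_ℝ + ε * ‖h‖}

/-- The graph `D⁻u` of the subdifferentials of `u`: the pairs `(x, p)` such that
`u (x + h) ≥ u x + p · h + o(|h|)` as `h → 0`. -/
def subGraph {N : ℕ} (u : Torus N → ℝ) : Set (Torus N × Space N) :=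
  {z | ∀ ε : ℝ, 0 < ε → ∀ᶠ h : Space N in 𝓝 0,
    u z.1 + ⟪z.2, h⟫_ℝ - ε * ‖h‖ ≤ u (z.1 + proj h)}

/-- The supremum of `H` over `G`, in `[-∞, ∞]`. -/
def supOn {N : ℕ} (H : Torus N × Space N → ℝ) (G : Set (Torus N × Space N)) : EReal :=
  ⨆ z ∈ G, (H z : EReal)

/-- The infimum of `H` over `G`, in `[-∞, ∞]`. -/
def infOn {N : ℕ} (H : Torus N × Space N → ℝ) (G : Set (Torus N × Space N)) : EReal :=
  ⨅ z ∈ G, (H z : EReal)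

/-- `u` is a (Lipschitz) viscosity subsolution of `H(x, Du) = a` on the torus. -/
def IsSubsolution {N : ℕ} (H : Torus N × Space N → ℝ) (a : ℝ) (u : Torus N → ℝ) : Prop :=
  u ∈ Lip N ∧ supOn H (superGraph u) ≤ (a : EReal)

/-- `u` is a (Lipschitz) viscosity supersolution of `H(x, Du) = a` on the torus. -/
def IsSupersolution {N : ℕ} (H : Torus N × Space N → ℝ) (a : ℝ) (u : Torus N → ℝ) : Prop :=
  u ∈ Lip N ∧ (a : EReal) ≤ infOn H (subGraph u)

/-- `u` is a (Lipschitz) viscosity solution of `H(x, Du) = a` on the torus. -/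
def IsSolution {N : ℕ} (H : Torus N × Space N → ℝ) (a : ℝ) (u : Torus N → ℝ) : Prop :=
  IsSubsolution H a u ∧ IsSupersolution H a u

def IsSubeigenvalue {N : ℕ} (H : Torus N × Space N → ℝ) (a : ℝ) : Prop :=
  ∃ u, IsSubsolution H a u

def IsSupereigenvalue {N : ℕ} (H : Torus N × Space N → ℝ) (a : ℝ) : Prop :=
  ∃ u, IsSupersolution H a u

def IsEigenvalue {N : ℕ} (H : Torus N × Space N → ℝ) (a : ℝ) : Prop :=
  ∃ u, IsSolution H a u

/-- The upper critical value `c⁺(H)`, the infimum of the subeigenvalues, in `[-∞, ∞]`. -/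
def upperCritical {N : ℕ} (H : Torus N × Space N → ℝ) : EReal :=
  ⨅ (a : ℝ) (_ : IsSubeigenvalue H a), (a : EReal)

/-- The lower critical value `c⁻(H)`, the supremum of the supereigenvalues, in `[-∞, ∞]`. -/
def lowerCritical {N : ℕ} (H : Torus N × Space N → ℝ) : EReal :=
  ⨆ (a : ℝ) (_ : IsSupereigenvalue H a), (a : EReal)

/-- Quasiconvexity of `H` in the gradient variable. -/
def QuasiconvexInP {N : ℕ} (H : Torus N × Space N → ℝ) : Prop :=
  ∀ x : Torus N, QuasiconvexOn ℝ univ (fun p : Space N => H (x, p))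

/-- Coercivity of `H` in the gradient variable, uniformly on the torus:
`liminf_{|p| → ∞} inf_x H(x, p) = +∞`. -/
def Coercive {N : ℕ} (H : Torus N × Space N → ℝ) : Prop :=
  liminf (fun p : Space N => ⨅ x : Torus N, (H (x, p) : EReal)) (Bornology.cobounded (Space N)) = ⊤

end HamiltonJacobi

end

/-! The two formulas come from the cycle inf over Lip ≤ c⁺ ≤ inf over C^∞ ≤ inf over Lip. The first
inequality holds because a gradient is a supergradient, the second because a smooth function has no
other supergradients. The third is mollification (`exists_contDiff_gradient_mem`): gradients of the
mollified function are averages of nearby gradients, and an average cannot leave a closed convex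
sublevel set of `H (x, ·)`. This is where quasiconvexity enters; uniform continuity pays for moving
the base point.

Touching a supersolution from below by a smooth function gives c⁻ ≤ inf over C^∞, hence c⁻ ≤ c⁺. An
eigenvalue b satisfies c⁺ ≤ b ≤ c⁻ by definition, so all three agree and b is unique. Existence,
under coercivity, needs no quasiconvexity: Perron's method solves `lam * v + H(x, Dv) = 0`
(`exists_discounted_solution`) with a Lipschitz bound independent of `lam`, and `lam → 0` yields an
eigenvalue (`exists_ergodic_solution`). -/

namespace HamiltonJacobi

/-! ### Calculus of supergradients on a Euclidean space -/

section Supergradient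

variable {E : Type*} [NormedAddCommGroup E] [InnerProductSpace ℝ E]

/-- `p` is a superdifferential of `f` at `x`: `f (x + h) ≤ f x + p · h + o(|h|)` as `h → 0`. -/
def IsSupergradient (f : E → ℝ) (x p : E) : Prop :=
  ∀ ε : ℝ, 0 < ε → ∀ᶠ h : E in 𝓝 0, f (x + h) ≤ f x + ⟪p, h⟫_ℝ + ε * ‖h‖

theorem IsSupergradient.anti {f g : E → ℝ} {x p : E} (h : IsSupergradient g x p)
    (hle : ∀ᶠ y in 𝓝 x, f y ≤ g y) (heq : f x = g x) : IsSupergradient f x p := by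
  intro ε hε
  have hle' : ∀ᶠ k : E in 𝓝 0, f (x + k) ≤ g (x + k) := by
    have : Tendsto (fun k : E => x + k) (𝓝 0) (𝓝 x) := by
      simpa using (continuous_const_add x).tendsto 0
    exact this.eventually hle
  filter_upwards [h ε hε, hle'] with k hk hk'
  rw [heq]
  exact hk'.trans hk

/-- Invariance of supergradients under a change of coordinates by translation. -/
theorem isSupergradient_comp_add {f : E → ℝ} {x k p : E} :
    IsSupergradient (fun y => f (y + k)) x p ↔ IsSupergradient f (x + k) p := by
  have (h : E) : x + h + k = x + k + h := by abel
  simp only [IsSupergradient, this]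

section Gradient

variable [CompleteSpace E]

theorem _root_.HasGradientAt.abs_sub_le {f : E → ℝ} {x p : E} (h : HasGradientAt f p x) {ε : ℝ}
    (hε : 0 < ε) : ∀ᶠ k : E in 𝓝 0, |f (x + k) - f x - ⟪p, k⟫_ℝ| ≤ ε * ‖k‖ :=
  (hasGradientAt_iff_isLittleO_nhds_zero.1 h).bound hε

theorem _root_.HasGradientAt.isSupergradient {f : E → ℝ} {x p : E} (h : HasGradientAt f p x) :
    IsSupergradient f x p := by
  intro ε hε
  filter_upwards [h.abs_sub_le hε] with k hk
  linarith [(abs_le.1 hk).2]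

theorem IsSupergradient.of_sub_le {f g : E → ℝ} {x p : E} (hg : HasGradientAt g p x)
    (h : ∀ᶠ y in 𝓝 x, f y - g y ≤ f x - g x) : IsSupergradient f x p := by
  have hg' : HasGradientAt (fun y => g y + (f x - g x)) p x := hg.add_const _
  refine hg'.isSupergradient.anti ?_ (by ring)
  filter_upwards [h] with y hy
  linarith

end Gradient

/-- A supergradient is close to the slope of any cone that touches the function from below. -/
theorem IsSupergradient.norm_sub_le {f : E → ℝ} {x p q : E} {ε : ℝ} (hq : IsSupergradient f x q)
    (hε : 0 ≤ ε) (h : ∀ᶠ k : E in 𝓝 0, f x + ⟪p, k⟫_ℝ - ε * ‖k‖ ≤ f (x + k)) :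
    ‖q - p‖ ≤ ε := by
  refine le_of_forall_pos_le_add fun δ hδ => ?_
  rcases eq_or_ne p q with rfl | hne
  · simp; positivity
  have hpos : 0 < ‖p - q‖ := norm_pos_iff.2 (sub_ne_zero.2 hne)
  -- Compare both bounds on `f` along the ray in direction `p - q`, where the linear parts differ by
  -- `t * ‖p - q‖ ^ 2`.
  have ht : Tendsto (fun t : ℝ => t • (p - q)) (𝓝[>] 0) (𝓝 0) := by
    have : Tendsto (fun t : ℝ => t • (p - q)) (𝓝 0) (𝓝 ((0 : ℝ) • (p - q))) :=
      (continuous_id.smul continuous_const).tendsto 0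
    rw [zero_smul] at this
    exact this.mono_left nhdsWithin_le_nhds
  obtain ⟨t, ⟨h1, h2⟩, ht0⟩ :=
    ((ht.eventually (h.and (hq δ hδ))).and self_mem_nhdsWithin).exists
  have ht0 : 0 < t := ht0
  have h3 : ⟪p, t • (p - q)⟫_ℝ - ⟪q, t • (p - q)⟫_ℝ = t * ‖p - q‖ ^ 2 := by
    rw [← inner_sub_left, inner_smul_right, real_inner_self_eq_norm_sq]
  have h4 : ‖t • (p - q)‖ = t * ‖p - q‖ := by rw [norm_smul, Real.norm_of_nonneg ht0.le]
  rw [h4] at h1 h2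
  rw [norm_sub_rev]
  have h5 : (t * ‖p - q‖) * ‖p - q‖ ≤ (t * ‖p - q‖) * (ε + δ) := by nlinarith
  exact le_of_mul_le_mul_left h5 (by positivity)

theorem IsSupergradient.eq_of_hasGradientAt [CompleteSpace E] {f : E → ℝ} {x p q : E}
    (hq : IsSupergradient f x q) (h : HasGradientAt f p x) : q = p := by
  rw [← sub_eq_zero, ← norm_le_zero_iff]
  refine le_of_forall_pos_le_add fun δ hδ => ?_
  rw [zero_add]
  refine hq.norm_sub_le hδ.le ?_
  filter_upwards [h.abs_sub_le hδ] with k hk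
  linarith [(abs_le.1 hk).1]

variable [FiniteDimensional ℝ E]

/-- A bounded continuous function whose supergradients are bounded by `K` is `K`-Lipschitz. -/
theorem le_add_mul_norm_of_supergradient_le {f : E → ℝ} {K B : ℝ} (hf : Continuous f)
    (hB : ∀ x, f x ≤ B) (hK : ∀ x p, IsSupergradient f x p → ‖p‖ ≤ K) (hK0 : 0 ≤ K) (x y : E) :
    f y ≤ f x + K * ‖y - x‖ := by
  have : CompleteSpace E := FiniteDimensional.complete ℝ E
  have : ProperSpace E := FiniteDimensional.proper ℝ E
  -- For `L > K`, a maximum of `f - L * ‖· - x‖` away from `x` would give a supergradient of norm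
  -- `L`, so the maximum is at `x`.
  suffices H : ∀ L, K < L → f y ≤ f x + L * ‖y - x‖ by
    have ht : Tendsto (fun L : ℝ => f x + L * ‖y - x‖) (𝓝[>] K) (𝓝 (f x + K * ‖y - x‖)) :=
      ((continuous_const.add (continuous_id.mul continuous_const)).tendsto K).mono_left
        nhdsWithin_le_nhds
    exact ge_of_tendsto ht (by filter_upwards [self_mem_nhdsWithin] with L hL using H L hL)
  intro L hL
  have hL0 : 0 < L := hK0.trans_lt hL
  have hcont : Continuous fun z => f z - L * ‖z - x‖ := by fun_prop
  obtain ⟨z, hz⟩ : ∃ z, ∀ w, f w - L * ‖w - x‖ ≤ f z - L * ‖z - x‖ := by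
    refine hcont.exists_forall_ge' x ?_
    have h1 : Tendsto (fun z : E => ‖z - x‖) (cocompact E) atTop := by
      have := tendsto_dist_right_cocompact_atTop (α := E) x
      simpa [dist_eq_norm] using this
    filter_upwards [h1.eventually_ge_atTop ((B - f x) / L)] with w hw
    rw [div_le_iff₀ hL0] at hw
    have := hB w
    simp only [sub_self, norm_zero, mul_zero, sub_zero]
    linarith
  rcases eq_or_ne z x with rfl | hne
  · have := hz y
    simp only [sub_self, norm_zero, mul_zero, sub_zero] at this
    linarith
  · exfalso
    have hd : DifferentiableAt ℝ (fun w : E => ‖w‖) (z - x) :=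
      (contDiffAt_norm ℝ (n := 1) (sub_ne_zero.2 hne)).differentiableAt (by norm_num)
    have hfd : HasFDerivAt (fun w : E => L * ‖w - x‖) (L • fderiv ℝ (fun w : E => ‖w‖) (z - x)) z := by
      have h1 : HasFDerivAt (fun w : E => ‖w‖) (fderiv ℝ (fun w : E => ‖w‖) (z - x)) (z - x) :=
        hd.hasFDerivAt
      have h2 := (h1.comp z ((hasFDerivAt_id z).sub_const x)).const_mul L
      simpa using h2
    have hsup := IsSupergradient.of_sub_le (f := f) hfd.hasGradientAt (Eventually.of_forall hz)
    have hle := hK _ _ hsup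
    have : Nontrivial E := ⟨z, x, hne⟩
    rw [LinearIsometryEquiv.norm_map, norm_smul, norm_fderiv_norm hd,
      Real.norm_of_nonneg hL0.le] at hle
    linarith

/-- Supergradients persist, approximately, under approximate touching from below. -/
theorem IsSupergradient.exists_near {v : E → ℝ} {x p : E} {ε : ℝ} (hv : IsSupergradient v x p)
    (hε : 0 < ε) : ∃ η > 0, ∀ w : E → ℝ, Continuous w →
      (∀ y, ‖y - x‖ ≤ ε → w y ≤ v y + η) → v x - η ≤ w x →
      ∃ y q, ‖y - x‖ ≤ ε ∧ ‖q - p‖ ≤ ε ∧ IsSupergradient w y q := by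
  have : CompleteSpace E := FiniteDimensional.complete ℝ E
  have : ProperSpace E := FiniteDimensional.proper ℝ E
  obtain ⟨ρ, hρ, hball⟩ := Metric.eventually_nhds_iff.1 (hv (ε / 4) (by positivity))
  set r := min (ρ / 2) ε with hr
  have hr0 : 0 < r := lt_min (by positivity) hε
  have hrρ : r < ρ := (min_le_left _ _).trans_lt (by linarith)
  have hrε : r ≤ ε := min_le_right _ _
  -- On the sphere of radius `r` the quadratic penalty is `ε * r / 2`, while the expansion of `v`
  -- loses `ε * r / 4`. The remaining `ε * r / 4` exceeds `2 * η`, so the maximum is interior.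
  refine ⟨ε / 4 * r / 4, by positivity, fun w hw hwv hwx => ?_⟩
  have hg (y : E) : HasGradientAt (fun y => ⟪p, y - x⟫_ℝ + ε / (2 * r) * ‖y - x‖ ^ 2)
      (p + (ε / r) • (y - x)) y := by
    have h1 : HasFDerivAt (fun y : E => y - x) (ContinuousLinearMap.id ℝ E) y :=
      (hasFDerivAt_id y).sub_const x
    have h2 := ((innerSL ℝ p).hasFDerivAt.comp y h1).add (h1.norm_sq.const_mul (ε / (2 * r)))
    rw [hasGradientAt_iff_hasFDerivAt]
    refine h2.congr_fderiv ?_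
    ext k
    simp
    field_simp
  have hcont : Continuous fun y => w y - (⟪p, y - x⟫_ℝ + ε / (2 * r) * ‖y - x‖ ^ 2) := by fun_prop
  obtain ⟨y, hy, hmax⟩ := (isCompact_closedBall x r).exists_isMaxOn
    ⟨x, Metric.mem_closedBall_self hr0.le⟩ hcont.continuousOn
  have hyr : ‖y - x‖ ≤ r := by simpa [dist_eq_norm] using hy
  have hylt : ‖y - x‖ < r := by
    refine lt_of_le_of_ne hyr fun heq => ?_
    have h1 := hmax (Metric.mem_closedBall_self hr0.le)
    simp only [mem_ofPred_eq, sub_self, norm_zero, inner_zero_right, heq] at h1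
    have h2 := hball (y := y - x) (by rw [dist_zero_right, heq]; exact hrρ)
    rw [add_sub_cancel, heq] at h2
    have h3 := hwv y (hyr.trans hrε)
    have h4 : ε / (2 * r) * r ^ 2 = ε * r / 2 := by field_simp
    rw [h4] at h1
    have : 0 < ε * r := by positivity
    linarith
  refine ⟨y, p + (ε / r) • (y - x), hyr.trans hrε, ?_, ?_⟩
  · rw [add_sub_cancel_left, norm_smul, Real.norm_of_nonneg (by positivity)]
    calc ε / r * ‖y - x‖ ≤ ε / r * r := by gcongr
      _ = ε := by field_simp
  · refine IsSupergradient.of_sub_le (hg y) ?_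
    have : Metric.closedBall x r ∈ 𝓝 y :=
      mem_of_superset (Metric.isOpen_ball.mem_nhds (by simpa [dist_eq_norm] using hylt))
        Metric.ball_subset_closedBall
    filter_upwards [this] with z hz
    exact hmax hz

end Supergradient

/-! ### Mollification and averages of gradients -/

section Mollification

open MeasureTheory
open scoped Convolution

variable {E : Type*} [NormedAddCommGroup E] [InnerProductSpace ℝ E] [FiniteDimensional ℝ E]

/-- A mollification of a Lipschitz function: its gradients are averages of nearby gradients of the
function, by Rademacher's theorem. -/
theorem exists_contDiff_gradient_mem {u : E → ℝ} {K : NNReal} (hu : LipschitzWith K u) {δ : ℝ}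
    (hδ : 0 < δ) : ∃ w : E → ℝ, ContDiff ℝ ∞ w ∧
      (∀ k, (∀ x, u (x + k) = u x) → ∀ x, w (x + k) = w x) ∧
      ∀ (x : E) (S : Set E), Convex ℝ S → IsClosed S →
        (∀ y p, ‖y - x‖ < δ → HasGradientAt u p y → p ∈ S) → ∀ q, HasGradientAt w q x → q ∈ S := by
  have : CompleteSpace E := FiniteDimensional.complete ℝ E
  borelize E
  let μ : Measure E := Measure.addHaar
  let φ : ContDiffBump (0 : E) := ⟨δ / 2, δ, by positivity, by linarith⟩
  let ρ : E → ℝ := φ.normed μ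
  have hρ0 : ∀ t, 0 ≤ ρ t := φ.nonneg_normed
  have hρc : Continuous ρ := φ.continuous_normed
  have hρi : Integrable ρ μ := φ.integrable_normed
  have hρs : HasCompactSupport ρ := φ.hasCompactSupport_normed
  -- As `ν` is a probability measure, the gradient of `w` is a barycentre of gradients of `u`, and
  -- convexity applies.
  let ν : Measure E := μ.withDensity fun t => ENNReal.ofReal (ρ t)
  have hν : IsProbabilityMeasure ν := by
    refine ⟨?_⟩
    rw [withDensity_apply _ MeasurableSet.univ, Measure.restrict_univ,
      ← ofReal_integral_eq_lintegral_ofReal hρi (Eventually.of_forall hρ0), φ.integral_normed,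
      ENNReal.ofReal_one]
  let w : E → ℝ := fun x => ∫ t, ρ t * u (x - t) ∂μ
  refine ⟨w, ?_, ?_, ?_⟩
  · have := hρs.contDiff_convolution_left (ContinuousLinearMap.lsmul ℝ ℝ) (n := ⊤)
      (φ.contDiff_normed (μ := μ)) (hu.continuous.locallyIntegrable (μ := μ))
    exact this
  · intro k hk x
    have (t : E) : x + k - t = x - t + k := by abel
    simp only [w, this, hk]
  · intro x S hSc hScl hS q hq
    have hdiff : ∀ᵐ t ∂μ, DifferentiableAt ℝ u (x - t) :=
      (quasiMeasurePreserving_sub_left μ x).ae hu.ae_differentiableAt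
    have hmeas : Measurable fun t => fderiv ℝ u (x - t) :=
      (measurable_fderiv ℝ u).comp (measurable_const.sub measurable_id)
    have hderiv := hasFDerivAt_integral_of_dominated_loc_of_lip (μ := μ) (s := univ)
      (F := fun x t => ρ t * u (x - t)) (F' := fun t => ρ t • fderiv ℝ u (x - t)) (x₀ := x)
      (bound := fun t => ρ t * K) univ_mem
      (Eventually.of_forall fun y => (hρc.mul
        (hu.continuous.comp (continuous_const.sub continuous_id))).aestronglyMeasurable)
      ((hρc.mul (hu.continuous.comp (continuous_const.sub continuous_id))).integrable_of_hasCompactSupport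
        hρs.mul_right)
      (hρc.measurable.smul hmeas).aestronglyMeasurable
      (Eventually.of_forall fun t => by
        refine LipschitzOnWith.of_dist_le_mul fun y _ z _ => ?_
        have h1 := hu.dist_le_mul (y - t) (z - t)
        rw [dist_sub_right] at h1
        rw [Real.dist_eq, ← mul_sub, abs_mul, abs_of_nonneg (hρ0 t), ← Real.dist_eq,
          Real.coe_nnabs, abs_of_nonneg (mul_nonneg (hρ0 t) K.coe_nonneg), mul_assoc]
        exact mul_le_mul_of_nonneg_left h1 (hρ0 t))
      (hρi.mul_const _)
      (by
        filter_upwards [hdiff] with t ht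
        have h1 : HasFDerivAt (fun y : E => y - t) (ContinuousLinearMap.id ℝ E) x :=
          (hasFDerivAt_id x).sub_const t
        simpa using (ht.hasFDerivAt.comp x h1).const_mul (ρ t))
    have hint : ∫ t, fderiv ℝ u (x - t) ∂ν = ∫ t, ρ t • fderiv ℝ u (x - t) ∂μ := by
      have h1 := integral_withDensity_eq_integral_toReal_smul (μ := μ)
        (f := fun t => ENNReal.ofReal (ρ t)) hρc.measurable.ennreal_ofReal
        (Eventually.of_forall fun t => ENNReal.ofReal_lt_top) (fun t => fderiv ℝ u (x - t))
      simpa only [ENNReal.toReal_ofReal (hρ0 _)] using h1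
    have hintegrable : Integrable (fun t => fderiv ℝ u (x - t)) ν := by
      refine Integrable.of_bound hmeas.aestronglyMeasurable (K : ℝ)
        (Eventually.of_forall fun t => norm_fderiv_le_of_lipschitz ℝ hu)
    have hmem : ∫ t, fderiv ℝ u (x - t) ∂ν ∈
        {L | (InnerProductSpace.toDual ℝ E).symm L ∈ S} := by
      refine Convex.integral_mem ?_ ?_ ?_ hintegrable
      · intro L hL M hM a b ha hb hab
        simp only [mem_ofPred_eq, map_add, map_smulₛₗ] at hL hM ⊢
        exact hSc hL hM ha hb hab
      · exact hScl.preimage (InnerProductSpace.toDual ℝ E).symm.continuous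
      · refine (ae_withDensity_iff hρc.measurable.ennreal_ofReal).2 ?_
        filter_upwards [hdiff] with t ht ht0
        refine hS (x - t) _ ?_ ht.hasGradientAt
        have h1 : t ∈ Function.support ρ := fun h => ht0 (by simp [h])
        rw [φ.support_normed_eq] at h1
        simpa using h1
    rw [hint] at hmem
    rw [hq.unique hderiv.2.hasGradientAt]
    exact hmem

end Mollification

/-! ### Perron's method for the discounted equation -/

section Perron

theorem dist_triple_lt {E : Type*} [SeminormedAddCommGroup E] {a b δ : ℝ} {x y p q : E}
    (h₁ : |a - b| < δ) (h₂ : ‖y - x‖ < δ) (h₃ : ‖q - p‖ < δ) :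
    dist (a, y, q) (b, x, p) < δ := by
  simp only [Prod.dist_eq, max_lt_iff]
  simpa only [dist_eq_norm, Real.dist_eq] using ⟨h₁, h₂, h₃⟩

variable {E : Type*} [NormedAddCommGroup E] [InnerProductSpace ℝ E]

theorem IsSupergradient.const_add {f : E → ℝ} {x p : E} (h : IsSupergradient f x p) (c : ℝ) :
    IsSupergradient (fun y => c + f y) x p := by
  intro ε hε
  filter_upwards [h ε hε] with k hk
  linarith

theorem IsSupergradient.eq_zero_of_const [CompleteSpace E] {c : ℝ} {x p : E}
    (h : IsSupergradient (fun _ : E => c) x p) : p = 0 :=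
  h.eq_of_hasGradientAt (hasGradientAt_const x c)

/-- A downward cone has supergradients close to its slope at the vertex. -/
theorem IsSupergradient.norm_sub_le_of_cone {x y p q : E} {a ε : ℝ} (hε : 0 ≤ ε)
    (h : IsSupergradient (fun z => a + ⟪p, z - x⟫_ℝ - ε * ‖z - x‖) y q) : ‖q - p‖ ≤ ε := by
  refine h.norm_sub_le hε (Eventually.of_forall fun k => ?_)
  have h1 : y + k - x = (y - x) + k := by abel
  have h2 := mul_le_mul_of_nonneg_left (norm_add_le (y - x) k) hε
  simp only [h1, inner_add_right]
  linarith

variable [FiniteDimensional ℝ E] {G : E × E → ℝ} {m M K : ℝ}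

/-- Bounded viscosity subsolutions of the discounted equation `lam * u + G(x, Du) = 0`. -/
def discountedSubsolutions (G : E × E → ℝ) (m M lam : ℝ) : Set (E → ℝ) :=
  {w | Continuous w ∧ (∀ x, -M ≤ lam * w x ∧ lam * w x ≤ -m) ∧
    ∀ x p, IsSupergradient w x p → lam * w x + G (x, p) ≤ 0}

/-- At a supergradient, `G ≤ -lam * w ≤ M`, and coercivity bounds the slope by `K`. That `K` does
not depend on `lam` gives the compactness as `lam → 0`. -/
theorem le_add_mul_norm_of_mem_discountedSubsolutions
    (hM : ∀ x, G (x, 0) ≤ M) (hK : ∀ x p, G (x, p) ≤ M → ‖p‖ ≤ K) {lam : ℝ} (hlam : 0 < lam)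
    {w : E → ℝ} (hw : w ∈ discountedSubsolutions G m M lam) (x y : E) :
    w y ≤ w x + K * ‖y - x‖ := by
  refine le_add_mul_norm_of_supergradient_le (B := -m / lam) hw.1 (fun z => ?_)
    (fun z p hp => hK z p ?_) ((norm_nonneg _).trans (hK 0 0 (hM 0))) x y
  · rw [le_div_iff₀' hlam]
    exact (hw.2.1 z).2
  · linarith [hw.2.2 z p hp, (hw.2.1 z).1]

/-- Perron's method for the discounted equation with a coercive Hamiltonian. -/
theorem exists_discounted_solution (hG : Continuous G) (hm : ∀ z, m ≤ G z)
    (hM : ∀ x, G (x, 0) ≤ M) (hK : ∀ x p, G (x, p) ≤ M → ‖p‖ ≤ K) {lam : ℝ} (hlam : 0 < lam) :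
    ∃ v : E → ℝ, (∀ k, (∀ x p, G (x + k, p) = G (x, p)) → ∀ x, v (x + k) = v x) ∧
      (∀ x y, v y ≤ v x + K * ‖y - x‖) ∧ (∀ x, -M ≤ lam * v x ∧ lam * v x ≤ -m) ∧
      (∀ x p, IsSupergradient v x p → lam * v x + G (x, p) ≤ 0) ∧
      (∀ x p, IsSupergradient (-v) x (-p) → 0 ≤ lam * v x + G (x, p)) := by
  have : CompleteSpace E := FiniteDimensional.complete ℝ E
  have hK0 : 0 ≤ K := (norm_nonneg _).trans (hK 0 0 (hM 0))
  set 𝒮 := discountedSubsolutions G m M lam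
  have hlip {w : E → ℝ} (hw : w ∈ 𝒮) (x y : E) : w y ≤ w x + K * ‖y - x‖ :=
    le_add_mul_norm_of_mem_discountedSubsolutions hM hK hlam hw x y
  have hconst : (fun _ => -M / lam) ∈ 𝒮 := by
    refine ⟨continuous_const, fun x => ?_, fun x p hp => ?_⟩
    · rw [mul_div_cancel₀ _ hlam.ne']
      exact ⟨le_rfl, neg_le_neg ((hm _).trans (hM 0))⟩
    · rw [hp.eq_zero_of_const, mul_div_cancel₀ _ hlam.ne']
      linarith [hM x]
  have : Nonempty 𝒮 := ⟨⟨_, hconst⟩⟩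
  set v : E → ℝ := fun x => ⨆ w : 𝒮, w.1 x with hv
  have hbdd (x : E) : BddAbove (range fun w : 𝒮 => w.1 x) := by
    refine ⟨-m / lam, ?_⟩
    rintro _ ⟨w, rfl⟩
    rw [le_div_iff₀' hlam]
    exact (w.2.2.1 x).2
  have hle {w : E → ℝ} (hw : w ∈ 𝒮) (x : E) : w x ≤ v x := le_ciSup (hbdd x) ⟨w, hw⟩
  have happrox (x : E) {η : ℝ} (hη : 0 < η) : ∃ w ∈ 𝒮, v x - η < w x := by
    obtain ⟨w, hw⟩ := exists_lt_of_lt_ciSup (show v x - η < ⨆ w : 𝒮, w.1 x by simp [hv, hη])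
    exact ⟨w.1, w.2, hw⟩
  have hvlip (x y : E) : v y ≤ v x + K * ‖y - x‖ :=
    ciSup_le fun w => (hlip w.2 x y).trans (by linarith [hle w.2 x])
  have hvc : Continuous v := by
    have : LipschitzWith K.toNNReal v := by
      refine LipschitzWith.of_le_add_mul' K fun x y => ?_
      rw [dist_eq_norm]
      exact hvlip y x
    exact this.continuous
  have hvb (x : E) : -M ≤ lam * v x ∧ lam * v x ≤ -m := by
    constructor
    · have := mul_le_mul_of_nonneg_left (hle hconst x) hlam.le
      rwa [mul_div_cancel₀ _ hlam.ne'] at this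
    · rw [← le_div_iff₀' hlam]
      refine ciSup_le fun w => ?_
      rw [le_div_iff₀' hlam]
      exact (w.2.2.1 x).2
  have hvsub (x p : E) (hp : IsSupergradient v x p) : lam * v x + G (x, p) ≤ 0 := by
    by_contra! hpos
    -- The first coordinate measures how far `w y` may fall below `v x`: with `z.1 = δ / 2`, one
    -- share is the defect of `w` at `x`, and `K` shares come from moving to `y`.
    have hΦ : Continuous fun z : ℝ × E × E => lam * (v x - z.1 * (1 + K)) + G z.2 := by fun_prop
    have hev : ∀ᶠ z in 𝓝 ((0 : ℝ), x, p), 0 < lam * (v x - z.1 * (1 + K)) + G z.2 :=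
      hΦ.continuousAt.eventually_const_lt (by simpa using hpos)
    obtain ⟨δ, hδ, hball⟩ := Metric.eventually_nhds_iff.1 hev
    obtain ⟨η, hη, hnear⟩ := hp.exists_near (ε := δ / 2) (by positivity)
    obtain ⟨w, hw, hwx⟩ := happrox x (lt_min hη (half_pos hδ))
    have h1 := min_le_left η (δ / 2)
    have h2 := min_le_right η (δ / 2)
    obtain ⟨y, q, hy, hq, hyq⟩ := hnear w hw.1 (fun y _ => by linarith [hle hw y]) (by linarith)
    have h3 := hball (y := (δ / 2, y, q)) (dist_triple_lt
      (by rw [sub_zero, abs_of_pos (half_pos hδ)]; linarith) (by linarith) (by linarith))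
    have h4 := hw.2.2 y q hyq
    have h5 := hlip hw y x
    rw [norm_sub_rev] at h5
    have h6 := mul_le_mul_of_nonneg_left hy hK0
    have h7 : v x - δ / 2 * (1 + K) ≤ w y := by linarith
    have h8 := mul_le_mul_of_nonneg_left h7 hlam.le
    simp only at h3
    linarith
  refine ⟨v, fun k hk => ?_, hvlip, hvb, hvsub, fun x p hp => ?_⟩
  · have hshift (k : E) (hk : ∀ x p, G (x + k, p) = G (x, p)) (x : E) : v (x + k) ≤ v x := by
      refine ciSup_le fun w => hle (w := fun y => w.1 (y + k)) ?_ x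
      refine ⟨w.2.1.comp (continuous_id.add continuous_const), fun y => w.2.2.1 (y + k),
        fun y p hp => ?_⟩
      rw [← hk]
      exact w.2.2.2 _ _ (isSupergradient_comp_add.1 hp)
    intro x
    refine le_antisymm (hshift k hk x) ?_
    have := hshift (-k) (fun y p => by rw [← hk, neg_add_cancel_right]) (x + k)
    rwa [add_neg_cancel_right] at this
  -- Where the supersolution inequality fails, a small downward cone with raised vertex is still a
  -- strict subsolution; gluing it onto `v` contradicts maximality.
  · by_contra! hneg
    have hΦ : Continuous fun z : ℝ × E × E => lam * z.1 + G z.2 := by fun_prop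
    have hev : ∀ᶠ z in 𝓝 (v x, x, p), lam * z.1 + G z.2 < 0 :=
      hΦ.continuousAt.eventually_lt_const hneg
    obtain ⟨δ, hδ, hball⟩ := Metric.eventually_nhds_iff.1 hev
    have hcone : Continuous fun h : E => |⟪p, h⟫_ℝ - δ / 2 * ‖h‖| := by fun_prop
    obtain ⟨ρ, hρ, hρball⟩ := Metric.eventually_nhds_iff.1
      ((hp (δ / 4) (by positivity)).and
        (((hcone.tendsto 0).eventually_lt_const (by simpa using hδ : _ < δ / 2)).and
          (Metric.ball_mem_nhds (0 : E) hδ)))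
    have hr : 0 < ρ / 2 := by positivity
    set r := ρ / 2 with hrdef
    -- The bound `δ / 4` keeps the cone within `δ` of `v x`; the bound `δ / 8 * r` keeps it below
    -- `v` on the sphere of radius `r`, where the gap before lifting is `δ / 4 * r`.
    set d := min (δ / 4) (δ / 8 * r) with hd
    have hd0 : 0 < d := lt_min (by positivity) (by positivity)
    have hd1 : d ≤ δ / 4 := min_le_left _ _
    have hd2 : d ≤ δ / 8 * r := min_le_right _ _
    set φ : E → ℝ := fun y => v x + d + ⟪p, y - x⟫_ℝ - δ / 2 * ‖y - x‖ with hφ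
    have hφc : Continuous φ := by fun_prop
    have hloc (y : E) (hy : ‖y - x‖ ≤ r) : v x + ⟪p, y - x⟫_ℝ - δ / 4 * ‖y - x‖ ≤ v y ∧
        |φ y - v x| < δ ∧ ‖y - x‖ < δ := by
      obtain ⟨h1, h2, h3⟩ := hρball (y := y - x) (by rw [dist_zero_right]; linarith)
      simp only [Pi.neg_apply, add_sub_cancel, inner_neg_left] at h1
      refine ⟨by linarith, ?_, by simpa using h3⟩
      rw [abs_lt] at h2 ⊢
      simp only [hφ]
      constructor <;> linarith [h2.1, h2.2]
    have hbdry (y : E) (hy : ‖y - x‖ = r) : φ y < v y := by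
      have := (hloc y hy.le).1
      simp only [hφ]
      rw [hy] at this ⊢
      have : 0 < δ * r := by positivity
      linarith
    have hval (y q : E) (hy : ‖y - x‖ ≤ r) (hq : ‖q - p‖ < δ) : lam * φ y + G (y, q) < 0 :=
      hball (y := (φ y, y, q)) (dist_triple_lt (hloc y hy).2.1 (hloc y hy).2.2 hq)
    let W : E → ℝ := fun y => if ‖y - x‖ ≤ r then max (v y) (φ y) else v y
    have hWc : Continuous W := by
      refine Continuous.if_le (hvc.max hφc) hvc (by fun_prop) continuous_const fun y hy => ?_
      exact max_eq_left (hbdry y hy).le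
    have hvW (y : E) : v y ≤ W y := by
      simp only [W]
      split_ifs
      exacts [le_max_left _ _, le_rfl]
    have hW (y : E) : W y = v y ∨ ‖y - x‖ < r ∧ W y = φ y := by
      simp only [W]
      split_ifs with hy
      · rcases le_total (φ y) (v y) with h | h
        · exact Or.inl (max_eq_left h)
        · exact Or.inr ⟨hy.lt_of_ne fun h' => (hbdry y h').not_ge h, max_eq_right h⟩
      · exact Or.inl rfl
    have hWmem : W ∈ 𝒮 := by
      refine ⟨hWc, fun y => ⟨?_, ?_⟩, fun y q hq => ?_⟩
      · exact (hvb y).1.trans (mul_le_mul_of_nonneg_left (hvW y) hlam.le)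
      · rcases hW y with h | ⟨hy, h⟩
        · rw [h]
          exact (hvb y).2
        · rw [h]
          linarith [hval y p hy.le (by simpa using hδ), hm (y, p)]
      · rcases hW y with h | ⟨hy, h⟩
        · rw [h]
          exact hvsub y q (hq.anti (Eventually.of_forall hvW) h.symm)
        · rw [h]
          have hlt : ∀ᶠ z in 𝓝 y, ‖z - x‖ < r :=
            (show Continuous fun z => ‖z - x‖ by fun_prop).continuousAt.eventually_lt_const hy
          have h1 : IsSupergradient φ y q := by
            refine hq.anti ?_ h.symm
            filter_upwards [hlt] with z hz
            simp only [W, if_pos hz.le]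
            exact le_max_right _ _
          have h2 : ‖q - p‖ ≤ δ / 2 := h1.norm_sub_le_of_cone (by positivity)
          exact (hval y q hy.le (by linarith)).le
    have h1 := hle hWmem x
    simp only [W, sub_self, norm_zero, if_pos hr.le, hφ, inner_zero_right] at h1
    linarith [le_max_right (v x) (v x + d + 0 - δ / 2 * 0)]

end Perron

/-! ### Vanishing discount -/

section Ergodic

/-- Pointwise convergence of an equi-Lipschitz family is uniform on compact sets. -/
theorem eventually_forall_abs_sub_le {ι E : Type*} [SeminormedAddCommGroup E] {l : Filter ι}
    {F : ι → E → ℝ} {f : E → ℝ} {K : ℝ} {C : Set E} (hK : 0 ≤ K)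
    (hF : ∀ n x y, F n y ≤ F n x + K * ‖y - x‖) (hf : ∀ x y, f y ≤ f x + K * ‖y - x‖)
    (hC : IsCompact C) (h : ∀ x, Tendsto (fun n => F n x) l (𝓝 (f x))) {η : ℝ} (hη : 0 < η) :
    ∀ᶠ n in l, ∀ x ∈ C, |F n x - f x| ≤ η := by
  have hr : 0 < η / (4 * (K + 1)) := by positivity
  obtain ⟨t, ht, hcov⟩ := Metric.totallyBounded_iff.1 hC.totallyBounded _ hr
  have hev : ∀ᶠ n in l, ∀ y ∈ t, |F n y - f y| < η / 2 := by
    refine (ht.eventually_all).2 fun y _ => ?_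
    have := Metric.tendsto_nhds.1 (h y) (η / 2) (by positivity)
    simpa [Real.dist_eq] using this
  filter_upwards [hev] with n hn x hx
  obtain ⟨y, hy, hxy⟩ := mem_iUnion₂.1 (hcov hx)
  rw [mem_ball_iff_norm] at hxy
  have h1 : K * ‖x - y‖ ≤ η / 4 := by
    calc K * ‖x - y‖ ≤ (K + 1) * (η / (4 * (K + 1))) := by gcongr; linarith
      _ = η / 4 := by field_simp
  have h2 := hF n x y
  have h3 := hF n y x
  have h4 := hf x y
  have h5 := hf y x
  rw [norm_sub_rev y x] at h2 h4
  have h6 := abs_lt.1 (hn y hy)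
  rw [abs_le]
  constructor <;> linarith [h6.1, h6.2]

variable {E : Type*} [NormedAddCommGroup E] [InnerProductSpace ℝ E] [FiniteDimensional ℝ E]

/-- Stability of supergradients under locally uniform limits. -/
theorem IsSupergradient.eventually_exists_near {ι : Type*} {l : Filter ι} {F : ι → E → ℝ}
    {f : E → ℝ} {x p : E} (hp : IsSupergradient f x p) (hF : ∀ n, Continuous (F n))
    (h : ∀ η > 0, ∀ r, ∀ᶠ n in l, ∀ y ∈ Metric.closedBall x r, |F n y - f y| ≤ η)
    {ε : ℝ} (hε : 0 < ε) :
    ∀ᶠ n in l, ∃ y q, ‖y - x‖ ≤ ε ∧ ‖q - p‖ ≤ ε ∧ IsSupergradient (F n) y q := by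
  obtain ⟨η, hη, hnear⟩ := hp.exists_near hε
  filter_upwards [h η hη ε] with n hn
  refine hnear _ (hF n) (fun y hy => ?_) ?_
  · linarith [(abs_le.1 (hn y (by simpa [dist_eq_norm] using hy))).2]
  · linarith [(abs_le.1 (hn x (Metric.mem_closedBall_self hε.le))).1]

/-- Solvability of the ergodic problem `G(x, Du) = c`, by vanishing discount. -/
theorem exists_ergodic_solution {G : E × E → ℝ} {m M K : ℝ} (hG : Continuous G)
    (hm : ∀ z, m ≤ G z) (hM : ∀ x, G (x, 0) ≤ M) (hK : ∀ x p, G (x, p) ≤ M → ‖p‖ ≤ K) :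
    ∃ (c : ℝ) (u : E → ℝ), (∀ k, (∀ x p, G (x + k, p) = G (x, p)) → ∀ x, u (x + k) = u x) ∧
      (∀ x y, u y ≤ u x + K * ‖y - x‖) ∧
      (∀ x p, IsSupergradient u x p → G (x, p) ≤ c) ∧
      (∀ x p, IsSupergradient (-u) x (-p) → c ≤ G (x, p)) := by
  have : ProperSpace E := FiniteDimensional.proper ℝ E
  have hK0 : 0 ≤ K := (norm_nonneg _).trans (hK 0 0 (hM 0))
  have hlam (n : ℕ) : (0 : ℝ) < 1 / ((n : ℝ) + 1) := Nat.one_div_pos_of_nat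
  choose v hvper hvlip hvb hvsub hvsuper using
    fun n : ℕ => exists_discounted_solution hG hm hM hK (hlam n)
  set lam : ℕ → ℝ := fun n => 1 / ((n : ℝ) + 1)
  -- Along an ultrafilter every bounded real sequence converges, so no diagonal extraction is
  -- needed.
  set l : Ultrafilter ℕ := hyperfilter ℕ
  have hlam0 : Tendsto lam l (𝓝 0) :=
    tendsto_one_div_add_atTop_nhds_zero_nat.mono_left Nat.hyperfilter_le_atTop
  have hlim (a : ℕ → ℝ) {A B : ℝ} (ha : ∀ n, a n ∈ Icc A B) :
      ∃ s ∈ Icc A B, Tendsto a l (𝓝 s) :=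
    isCompact_Icc.ultrafilter_le_nhds (l.map a)
      (le_principal_iff.2 (Eventually.of_forall ha : ∀ᶠ n in (l : Filter ℕ), a n ∈ Icc A B))
  obtain ⟨s, -, hs⟩ := hlim (fun n => lam n * v n 0) (fun n => hvb n 0)
  have hlip (n : ℕ) (x y : E) : -v n 0 + v n y ≤ -v n 0 + v n x + K * ‖y - x‖ := by
    linarith [hvlip n x y]
  have hpt (x : E) : ∃ s ∈ Icc (-(K * ‖x‖)) (K * ‖x‖),
      Tendsto (fun n => -v n 0 + v n x) l (𝓝 s) := by
    refine hlim _ fun n => ?_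
    have h1 := hvlip n 0 x
    have h2 := hvlip n x 0
    rw [sub_zero] at h1
    rw [zero_sub, norm_neg] at h2
    constructor <;> linarith
  choose u _ hu using hpt
  have hulip (x y : E) : u y ≤ u x + K * ‖y - x‖ :=
    le_of_tendsto_of_tendsto' (hu y) ((hu x).add_const _) fun n => hlip n x y
  have hvc (n : ℕ) : Continuous (v n) :=
    (LipschitzWith.of_le_add_mul' K fun x y => by
      rw [dist_eq_norm]; exact hvlip n y x).continuous
  have hunif (x : E) (η : ℝ) (hη : 0 < η) (r : ℝ) :
      ∀ᶠ n in (l : Filter ℕ), ∀ y ∈ Metric.closedBall x r, |-v n 0 + v n y - u y| ≤ η :=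
    eventually_forall_abs_sub_le hK0 hlip hulip (isCompact_closedBall x r) hu hη
  -- The oscillation of `lam n * v n` on a bounded set is `O(lam n)`, so its limit is the constant
  -- `s`; the eigenvalue is `-s`.
  have hval (x : E) {δ : ℝ} (hδ : 0 < δ) :
      ∀ᶠ n in (l : Filter ℕ), ∀ y, ‖y - x‖ ≤ δ → |lam n * v n y - s| < δ := by
    have h1 := Metric.tendsto_nhds.1 hs (δ / 2) (by positivity)
    have h2 : Tendsto (fun n => lam n * (K * (‖x‖ + δ))) l (𝓝 0) := by
      simpa using hlam0.mul_const (K * (‖x‖ + δ))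
    filter_upwards [h1, h2.eventually_lt_const (half_pos hδ)] with n hn1 hn2 y hy
    have h3 : ‖y‖ ≤ ‖x‖ + δ := by
      calc ‖y‖ = ‖x + (y - x)‖ := by rw [add_sub_cancel]
        _ ≤ ‖x‖ + ‖y - x‖ := norm_add_le _ _
        _ ≤ ‖x‖ + δ := by gcongr
    have h4 := hvlip n 0 y
    have h5 := hvlip n y 0
    rw [sub_zero] at h4
    rw [zero_sub, norm_neg] at h5
    have h6 : |v n y - v n 0| ≤ K * (‖x‖ + δ) := by
      have := mul_le_mul_of_nonneg_left h3 hK0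
      rw [abs_le]
      constructor <;> linarith
    have h7 : |lam n * v n y - lam n * v n 0| ≤ lam n * (K * (‖x‖ + δ)) := by
      rw [← mul_sub, abs_mul, abs_of_pos (hlam n)]
      exact mul_le_mul_of_nonneg_left h6 (hlam n).le
    rw [Real.dist_eq] at hn1
    have h8 := abs_sub_le (lam n * v n y) (lam n * v n 0) s
    linarith
  have hΦ : Continuous fun z : ℝ × E × E => z.1 + G z.2 := by fun_prop
  refine ⟨-s, u, fun k hk x => ?_, hulip, fun x p hp => ?_, fun x p hp => ?_⟩
  · refine tendsto_nhds_unique (hu (x + k)) ?_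
    simpa only [hvper _ k hk] using hu x
  · by_contra! hpos
    obtain ⟨δ, hδ, hball⟩ := Metric.eventually_nhds_iff.1
      ((hΦ.tendsto (s, x, p)).eventually_const_lt (by linarith : 0 < s + G (x, p)))
    obtain ⟨n, ⟨y, q, hy, hq, hyq⟩, hn⟩ := ((hp.eventually_exists_near
      (fun n => continuous_const.add (hvc n)) (hunif x) (half_pos hδ)).and
        (hval x (half_pos hδ))).exists
    have h1 : IsSupergradient (v n) y q := by simpa using hyq.const_add (v n 0)
    have h2 := hball (y := (lam n * v n y, y, q))
      (dist_triple_lt ((hn y hy).trans (by linarith)) (by linarith) (by linarith))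
    exact absurd (hvsub n y q h1) (not_le.2 h2)
  · by_contra! hneg
    obtain ⟨δ, hδ, hball⟩ := Metric.eventually_nhds_iff.1
      ((hΦ.tendsto (s, x, p)).eventually_lt_const (by linarith : s + G (x, p) < 0))
    have hunif' (η : ℝ) (hη : 0 < η) (r : ℝ) : ∀ᶠ n in (l : Filter ℕ),
        ∀ y ∈ Metric.closedBall x r, |v n 0 + (-v n) y - (-u) y| ≤ η := by
      filter_upwards [hunif x η hη r] with n hn y hy
      rw [← abs_neg]
      convert hn y hy using 2
      simp only [Pi.neg_apply]
      ring
    obtain ⟨n, ⟨y, q, hy, hq, hyq⟩, hn⟩ := ((hp.eventually_exists_near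
      (fun n => continuous_const.add (hvc n).neg) hunif' (half_pos hδ)).and
        (hval x (half_pos hδ))).exists
    have h1 : IsSupergradient (-v n) y (- -q) := by
      rw [neg_neg]
      exact (hyq.const_add (-v n 0)).anti (Eventually.of_forall fun z => by simp) (by simp)
    have h2 : ‖-q - p‖ ≤ δ / 2 := by
      rw [← norm_neg, show -(-q - p) = q - -p by abel]
      exact hq
    have h3 := hball (y := (lam n * v n y, y, -q))
      (dist_triple_lt ((hn y hy).trans (by linarith)) (by linarith) (by linarith))
    exact absurd (hvsuper n y (-q) h1) (not_le.2 h3)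

end Ergodic

/-! ### Periodic lifts between the torus and Euclidean space -/

section Torus

variable {N : ℕ}

theorem proj_add (a b : Space N) : proj (a + b) = proj a + proj b := rfl

theorem proj_sub (a b : Space N) : proj (a - b) = proj a - proj b := rfl

theorem proj_zero : proj (0 : Space N) = 0 := rfl

theorem norm_proj_le (a : Space N) : ‖proj a‖ ≤ ‖a‖ := by
  refine (pi_norm_le_iff_of_nonneg (norm_nonneg _)).2 fun i => ?_
  refine le_trans ?_ (PiLp.norm_apply_le a i)
  rw [proj, UnitAddCircle.norm_eq]
  simpa using round_le (a i) 0

theorem lipschitzWith_proj : LipschitzWith 1 (proj : Space N → Torus N) :=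
  LipschitzWith.of_dist_le_mul fun a b => by
    rw [dist_eq_norm, dist_eq_norm, ← proj_sub, NNReal.coe_one, one_mul]
    exact norm_proj_le _

/-- Rounding picks the shortest representative in each coordinate; `√N` compares the Euclidean norm
with the maximum norm. -/
theorem exists_lift (z : Torus N) : ∃ h : Space N, proj h = z ∧ ‖h‖ ≤ √N * ‖z‖ := by
  choose a ha using fun i => QuotientAddGroup.mk_surjective (z i)
  refine ⟨WithLp.toLp 2 fun i => a i - round (a i), ?_, ?_⟩
  · funext i
    rw [← ha i]
    simp only [proj]
    rw [AddCircle.coe_sub, sub_eq_self, AddCircle.coe_eq_zero_iff]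
    exact ⟨round (a i), by simp⟩
  · have hle (i : Fin N) : |a i - round (a i)| ≤ ‖z‖ := by
      have := norm_le_pi_norm z i
      rw [← ha i] at this
      rwa [← UnitAddCircle.norm_eq]
    rw [EuclideanSpace.norm_eq, ← Real.sqrt_sq (norm_nonneg z), ← Real.sqrt_mul (Nat.cast_nonneg N)]
    refine Real.sqrt_le_sqrt ?_
    calc ∑ i : Fin N, ‖a i - round (a i)‖ ^ 2 ≤ ∑ _i : Fin N, ‖z‖ ^ 2 :=
          Finset.sum_le_sum fun i _ => pow_le_pow_left₀ (norm_nonneg _) (hle i) 2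
      _ = N * ‖z‖ ^ 2 := by simp

theorem proj_surjective : Function.Surjective (proj : Space N → Torus N) := fun z =>
  (exists_lift z).imp fun _ h => h.1

theorem mem_Lip_of_comp_proj {u : Torus N → ℝ} {K : NNReal}
    (h : LipschitzWith K fun a => u (proj a)) : u ∈ Lip N := by
  refine ⟨K * NNReal.sqrt N, LipschitzWith.of_dist_le_mul fun x y => ?_⟩
  obtain ⟨a, rfl⟩ := proj_surjective x
  obtain ⟨k, hk, hle⟩ := exists_lift (proj a - y)
  have hy : y = proj (a - k) := by rw [proj_sub, hk, sub_sub_cancel]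
  rw [dist_eq_norm (proj a) y, hy]
  have h1 := h.dist_le_mul a (a - k)
  rw [dist_eq_norm a, sub_sub_cancel] at h1
  refine h1.trans ?_
  rw [← hy, NNReal.coe_mul, mul_assoc]
  exact mul_le_mul_of_nonneg_left (by simpa using hle) K.coe_nonneg

theorem exists_lipschitzWith_comp_proj {u : Torus N → ℝ} (hu : u ∈ Lip N) :
    ∃ K : NNReal, LipschitzWith K fun a => u (proj a) := by
  obtain ⟨K, hK⟩ := hu
  exact ⟨K * 1, hK.comp lipschitzWith_proj⟩

/-- A periodic function descends to the torus. -/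
theorem exists_comp_proj_eq {f : Space N → ℝ}
    (hf : ∀ k : Space N, proj k = 0 → ∀ a, f (a + k) = f a) :
    ∃ u : Torus N → ℝ, (fun a => u (proj a)) = f := by
  refine ⟨fun x => f (Function.surjInv proj_surjective x), funext fun a => ?_⟩
  have h := Function.surjInv_eq proj_surjective (proj a)
  have := hf (Function.surjInv proj_surjective (proj a) - a) (by rw [proj_sub, h, sub_self]) a
  rwa [add_sub_cancel] at this

theorem mem_gradGraph_iff {u : Torus N → ℝ} {a p : Space N} :
    (proj a, p) ∈ gradGraph u ↔ HasGradientAt (fun b => u (proj b)) p a := by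
  simp only [gradGraph, mem_ofPred_eq, hasGradientAt_iff_isLittleO_nhds_zero, proj_add, zero_add,
    proj_zero, add_zero]

theorem mem_superGraph_iff {u : Torus N → ℝ} {a p : Space N} :
    (proj a, p) ∈ superGraph u ↔ IsSupergradient (fun b => u (proj b)) a p := Iff.rfl

theorem mem_subGraph_iff {u : Torus N → ℝ} {a p : Space N} :
    (proj a, p) ∈ subGraph u ↔ IsSupergradient (-fun b => u (proj b)) a (-p) := by
  refine forall₂_congr fun ε _ => eventually_congr (Eventually.of_forall fun k => ?_)
  simp only [Pi.neg_apply, inner_neg_left, proj_add]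
  constructor <;> intro h <;> linarith

theorem gradGraph_subset_superGraph (u : Torus N → ℝ) : gradGraph u ⊆ superGraph u := by
  rintro ⟨x, p⟩ h
  obtain ⟨a, rfl⟩ := proj_surjective x
  exact mem_superGraph_iff.2 (mem_gradGraph_iff.1 h).isSupergradient

theorem Smooth.hasGradientAt {u : Torus N → ℝ} (hu : u ∈ Smooth N) (a : Space N) :
    HasGradientAt (fun b => u (proj b)) (gradient (fun b => u (proj b)) a) a :=
  ((show ContDiff ℝ ∞ fun b => u (proj b) from hu).differentiable (by simp) a).hasGradientAt

theorem Smooth.superGraph_eq {u : Torus N → ℝ} (hu : u ∈ Smooth N) :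
    superGraph u = gradGraph u := by
  refine Subset.antisymm ?_ (gradGraph_subset_superGraph u)
  rintro ⟨x, p⟩ h
  obtain ⟨a, rfl⟩ := proj_surjective x
  have := Smooth.hasGradientAt hu a
  rw [mem_gradGraph_iff, (mem_superGraph_iff.1 h).eq_of_hasGradientAt this]
  exact this

/-- The derivative of the lift is periodic, hence bounded by its supremum over a ball that meets
every fibre of `proj`. -/
theorem Smooth_subset_Lip : Smooth N ⊆ Lip N := by
  intro u hu
  set f : Space N → ℝ := fun a => u (proj a) with hf
  have hfd : ContDiff ℝ ∞ f := hu
  have hcont : Continuous fun a => ‖fderiv ℝ f a‖ := (hfd.continuous_fderiv (by simp)).norm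
  obtain ⟨R, hR⟩ := (isCompact_univ (X := Torus N)).isBounded.exists_norm_le
  obtain ⟨B, hB⟩ := (isCompact_closedBall (0 : Space N) (√N * R)).bddAbove_image hcont.continuousOn
  have hbound (a : Space N) : ‖fderiv ℝ f a‖ ≤ B := by
    obtain ⟨b, hb, hle⟩ := exists_lift (proj a)
    have heq : f = fun c => f (c + (a - b)) := by
      funext c
      simp only [hf, proj_add, proj_sub, hb, sub_self, add_zero]
    have h1 : fderiv ℝ f b = fderiv ℝ f a := by
      conv_lhs => rw [heq]
      rw [fderiv_comp_add_right, add_sub_cancel]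
    rw [← h1]
    refine hB (mem_image_of_mem _ ?_)
    rw [mem_closedBall_zero_iff]
    exact hle.trans (mul_le_mul_of_nonneg_left (hR _ (mem_univ _)) (Real.sqrt_nonneg _))
  have hB0 : 0 ≤ B := (norm_nonneg _).trans (hbound 0)
  exact mem_Lip_of_comp_proj (K := ⟨B, hB0⟩)
    (lipschitzWith_of_nnnorm_fderiv_le (hfd.differentiable (by simp)) fun a => hbound a)

end Torus

/-! ### Comparison of the critical values and the minimax values -/

section Minimax

variable {N : ℕ} {H : Torus N × Space N → ℝ}

theorem supOn_le_coe_iff {S : Set (Torus N × Space N)} {a : ℝ} :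
    supOn H S ≤ a ↔ ∀ z ∈ S, H z ≤ a := by
  simp only [supOn, iSup₂_le_iff, EReal.coe_le_coe_iff]

theorem coe_le_infOn_iff {S : Set (Torus N × Space N)} {a : ℝ} :
    (a : EReal) ≤ infOn H S ↔ ∀ z ∈ S, a ≤ H z := by
  simp only [infOn, le_iInf₂_iff, EReal.coe_le_coe_iff]

theorem iInf_Lip_le_upperCritical :
    ⨅ u ∈ Lip N, supOn H (gradGraph u) ≤ upperCritical H := by
  refine le_iInf₂ ?_
  rintro a ⟨u, hu, hle⟩
  exact (iInf₂_le u hu).trans ((biSup_mono (gradGraph_subset_superGraph u)).trans hle)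

theorem upperCritical_le_iInf_Smooth :
    upperCritical H ≤ ⨅ u ∈ Smooth N, supOn H (gradGraph u) := by
  refine le_iInf₂ fun u hu => EReal.le_of_forall_lt_iff_le.1 fun a ha => ?_
  refine iInf₂_le a ⟨u, Smooth_subset_Lip hu, ?_⟩
  rw [Smooth.superGraph_eq hu]
  exact ha.le

/-- Mollify at the scale on which `H` varies by less than `a - b` over the compact set of gradients
of norm at most `K`: nearby gradients of `u` then lie in the convex set `H (x, ·) ≤ a`. -/
theorem iInf_Smooth_le_iInf_Lip (hcont : Continuous H) (hquasi : QuasiconvexInP H) :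
    ⨅ u ∈ Smooth N, supOn H (gradGraph u) ≤ ⨅ u ∈ Lip N, supOn H (gradGraph u) := by
  refine le_iInf₂ fun u hu => EReal.le_of_forall_lt_iff_le.1 fun a ha => ?_
  obtain ⟨b, hb, hba⟩ := EReal.lt_iff_exists_real_btwn.1 ha
  rw [EReal.coe_lt_coe_iff] at hba
  have hb := supOn_le_coe_iff.1 hb.le
  obtain ⟨K, hK⟩ := exists_lipschitzWith_comp_proj hu
  have huc := ((isCompact_univ (X := Torus N)).prod
    (isCompact_closedBall (0 : Space N) K)).uniformContinuousOn_of_continuous hcont.continuousOn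
  obtain ⟨δ, hδ, hδH⟩ := Metric.uniformContinuousOn_iff.1 huc (a - b) (sub_pos.2 hba)
  obtain ⟨f, hf, hper, hgrad⟩ := exists_contDiff_gradient_mem hK hδ
  obtain ⟨w, hw⟩ := exists_comp_proj_eq (f := f) fun k hk =>
    hper k fun x => by rw [proj_add, hk, add_zero]
  refine iInf₂_le_of_le w (show ContDiff ℝ ∞ _ from hw ▸ hf) (supOn_le_coe_iff.2 ?_)
  rintro ⟨x, q⟩ hq
  obtain ⟨c, rfl⟩ := proj_surjective x
  rw [mem_gradGraph_iff, hw] at hq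
  have hmem := hgrad c (Metric.closedBall 0 K ∩ {p | p ∈ univ ∧ H (proj c, p) ≤ a})
    ((convex_closedBall 0 _).inter (hquasi (proj c) a))
    (Metric.isClosed_closedBall.inter (by
      simp only [mem_univ, true_and]
      exact isClosed_le (hcont.comp (Continuous.prodMk_right _)) continuous_const)) ?_ q hq
  · exact hmem.2.2
  · intro y p hy hp
    have hpK : p ∈ Metric.closedBall 0 (K : ℝ) := by
      rw [mem_closedBall_zero_iff, ← (InnerProductSpace.toDual ℝ (Space N)).norm_map]
      exact hp.hasFDerivAt.le_of_lipschitz hK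
    refine ⟨hpK, mem_univ _, ?_⟩
    have h1 := hb (proj y, p) (mem_gradGraph_iff.2 hp)
    have h2 := hδH (proj c, p) ⟨mem_univ _, hpK⟩ (proj y, p) ⟨mem_univ _, hpK⟩ (by
      rw [Prod.dist_eq, dist_self, max_eq_left dist_nonneg, dist_comm, dist_eq_norm, ← proj_sub]
      exact (norm_proj_le _).trans_lt hy)
    rw [Real.dist_eq] at h2
    linarith [(abs_lt.1 h2).2]

/-- At a minimum of `v - u` with `u` smooth, the gradient of `u` is a subgradient of the
supersolution `v`, so `a ≤ H` at a point of `gradGraph u`. -/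
theorem lowerCritical_le_iInf_Smooth :
    lowerCritical H ≤ ⨅ u ∈ Smooth N, supOn H (gradGraph u) := by
  refine iSup₂_le fun a ha => le_iInf₂ fun u hu => ?_
  obtain ⟨v, ⟨K, hv⟩, hva⟩ := ha
  obtain ⟨L, hu'⟩ := Smooth_subset_Lip hu
  obtain ⟨x, -, hx⟩ := isCompact_univ.exists_isMinOn (s := (univ : Set (Torus N)))
    ⟨0, mem_univ _⟩ (hv.continuous.sub hu'.continuous).continuousOn
  obtain ⟨b, rfl⟩ := proj_surjective x
  have hgrad := Smooth.hasGradientAt hu b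
  set q := gradient (fun b => u (proj b)) b
  have hsub : (proj b, q) ∈ subGraph v := by
    have hneg : HasGradientAt (-fun b => u (proj b)) (-q) b := by
      rw [hasGradientAt_iff_hasFDerivAt, map_neg]
      exact hgrad.hasFDerivAt.neg
    refine mem_subGraph_iff.2 (IsSupergradient.of_sub_le hneg ?_)
    refine Eventually.of_forall fun y => ?_
    have := hx (mem_univ (proj y))
    simp only [mem_ofPred_eq, Pi.sub_apply] at this
    simp only [Pi.neg_apply]
    linarith
  refine le_trans ?_ (le_iSup₂_of_le (proj b, q) (mem_gradGraph_iff.2 hgrad) le_rfl)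
  exact EReal.coe_le_coe_iff.2 (coe_le_infOn_iff.1 hva _ hsub)

theorem Coercive.exists_norm_le (hcoer : Coercive H) (R : ℝ) :
    ∃ K : ℝ, ∀ x p, H (x, p) ≤ R → ‖p‖ ≤ K := by
  have h1 := eventually_lt_of_lt_liminf (hcoer.symm ▸ EReal.coe_lt_top R)
  obtain ⟨K, -, hK⟩ := hasBasis_cobounded_norm.eventually_iff.1 h1
  refine ⟨K, fun x p hp => ?_⟩
  by_contra! hlt
  have h2 := (hK (x := p) hlt.le).trans_le (iInf_le _ x)
  exact absurd (EReal.coe_lt_coe_iff.1 h2) hp.not_gt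

theorem Coercive.exists_le (hcont : Continuous H) (hcoer : Coercive H) : ∃ m : ℝ, ∀ z, m ≤ H z := by
  obtain ⟨K, hK⟩ := hcoer.exists_norm_le 0
  obtain ⟨m, hm⟩ := ((isCompact_univ (X := Torus N)).prod
    (isCompact_closedBall (0 : Space N) K)).bddBelow_image hcont.continuousOn
  refine ⟨min m 0, fun z => ?_⟩
  rcases le_total (H z) 0 with h | h
  · exact (min_le_left _ _).trans (hm (mem_image_of_mem _
      ⟨mem_univ _, mem_closedBall_zero_iff.2 (hK z.1 z.2 h)⟩))
  · exact (min_le_right _ _).trans h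

theorem Coercive.exists_isEigenvalue (hcont : Continuous H) (hcoer : Coercive H) :
    ∃ c : ℝ, IsEigenvalue H c := by
  obtain ⟨m, hm⟩ := hcoer.exists_le hcont
  obtain ⟨M, hM⟩ := (isCompact_univ (X := Torus N)).bddAbove_image
    (hcont.comp (Continuous.prodMk_left (0 : Space N))).continuousOn
  obtain ⟨K, hK⟩ := hcoer.exists_norm_le M
  obtain ⟨c, f, hper, hlip, hsub, hsuper⟩ := exists_ergodic_solution
    (G := fun z : Space N × Space N => H (proj z.1, z.2)) (m := m) (M := M) (K := K)
    (hcont.comp ((lipschitzWith_proj.continuous.comp continuous_fst).prodMk continuous_snd))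
    (fun z => hm _) (fun x => hM (mem_image_of_mem _ (mem_univ (proj x)))) (fun x p => hK _ p)
  obtain ⟨u, rfl⟩ := exists_comp_proj_eq (f := f) fun k hk =>
    hper k fun x p => by simp only [proj_add, hk, add_zero]
  have hu : u ∈ Lip N := mem_Lip_of_comp_proj
    (LipschitzWith.of_le_add_mul' K fun x y => by rw [dist_eq_norm]; exact hlip y x)
  refine ⟨c, u, ⟨hu, supOn_le_coe_iff.2 ?_⟩, hu, coe_le_infOn_iff.2 ?_⟩
  · rintro ⟨x, p⟩ h
    obtain ⟨a, rfl⟩ := proj_surjective x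
    exact hsub a p (mem_superGraph_iff.1 h)
  · rintro ⟨x, p⟩ h
    obtain ⟨a, rfl⟩ := proj_surjective x
    exact hsuper a p (mem_subGraph_iff.1 h)

end Minimax

end HamiltonJacobi

theorem mainTheorem1 (N : ℕ)
    (H : HamiltonJacobi.Torus N × HamiltonJacobi.Space N → ℝ)
    (hcont : Continuous H) (hquasi : HamiltonJacobi.QuasiconvexInP H) :
    (HamiltonJacobi.upperCritical H =
        ⨅ u ∈ HamiltonJacobi.Lip N, HamiltonJacobi.supOn H (HamiltonJacobi.gradGraph u)) ∧
    ((⨅ u ∈ HamiltonJacobi.Lip N, HamiltonJacobi.supOn H (HamiltonJacobi.gradGraph u)) =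
        ⨅ u ∈ HamiltonJacobi.Smooth N, HamiltonJacobi.supOn H (HamiltonJacobi.gradGraph u)) ∧
    (HamiltonJacobi.Coercive H →
      ∃ c : ℝ,
        HamiltonJacobi.IsEigenvalue H c ∧
        (∀ b : ℝ, HamiltonJacobi.IsEigenvalue H b → b = c) ∧
        HamiltonJacobi.lowerCritical H = (c : EReal) ∧
        HamiltonJacobi.upperCritical H = (c : EReal) ∧
        (⨅ u ∈ HamiltonJacobi.Lip N,
          HamiltonJacobi.supOn H (HamiltonJacobi.gradGraph u)) = (c : EReal) ∧
        (⨅ u ∈ HamiltonJacobi.Smooth N,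
          HamiltonJacobi.supOn H (HamiltonJacobi.gradGraph u)) = (c : EReal)) := by
  have h₁ := HamiltonJacobi.iInf_Lip_le_upperCritical (H := H)
  have h₂ := HamiltonJacobi.upperCritical_le_iInf_Smooth (H := H)
  have h₃ := HamiltonJacobi.iInf_Smooth_le_iInf_Lip hcont hquasi
  have h₄ := HamiltonJacobi.lowerCritical_le_iInf_Smooth (H := H)
  have hupper := le_antisymm (h₂.trans h₃) h₁
  have hsmooth := le_antisymm (h₁.trans h₂) h₃
  refine ⟨hupper, hsmooth, fun hcoer => ?_⟩
  have hle : HamiltonJacobi.lowerCritical H ≤ HamiltonJacobi.upperCritical H :=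
    h₄.trans (h₃.trans h₁)
  have hupper_le {b : ℝ} (hb : HamiltonJacobi.IsEigenvalue H b) :
      HamiltonJacobi.upperCritical H ≤ b :=
    iInf₂_le b (hb.imp fun _ h => h.1)
  have hle_lower {b : ℝ} (hb : HamiltonJacobi.IsEigenvalue H b) :
      (b : EReal) ≤ HamiltonJacobi.lowerCritical H :=
    le_iSup₂_of_le b (hb.imp fun _ h => h.2) le_rfl
  -- The squeeze `b ≤ c⁻ ≤ c⁺ ≤ b` gives uniqueness and equality of the critical values together.
  have heq {b : ℝ} (hb : HamiltonJacobi.IsEigenvalue H b) :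
      HamiltonJacobi.upperCritical H = b :=
    le_antisymm (hupper_le hb) ((hle_lower hb).trans hle)
  obtain ⟨c, hc⟩ := hcoer.exists_isEigenvalue hcont
  refine ⟨c, hc, fun b hb => ?_, ?_, heq hc, ?_, ?_⟩
  · rw [← EReal.coe_eq_coe_iff, ← heq hb, heq hc]
  · exact le_antisymm (hle.trans (hupper_le hc)) (hle_lower hc)
  · rw [← hupper, heq hc]
  · rw [← hsmooth, ← hupper, heq hc]
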